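/- Let $A\in\mathbb{R}^{n\times n}$ be symmetric positive definite. For a symmetric positive definite matrix $P\in\mathbb{R}^{n\times n}$ put $$\mathcal{D}_{\mathrm{LD}}(A,P)=\operatorname{tr}(AP^{-1})-\log\det(AP^{-1})-n ,\qquad \|v\|_{P^{-1}}=(v^{\top}P^{-1}v)^{1/2}.$$ The preconditioned conjugate gradient method (PCG) for $Ax=b$ with preconditioner $P$ and initial guess $x_0$ is the iteration $r_0=b-Ax_0$, $p_0=P^{-1}r_0$ and, for $j=0,1,2,\dots$, $$\alpha_j=\frac{r_j^{\top}P^{-1}r_j}{p_j^{\top}Ap_j},\quad x_{j+1}=x_j+\alpha_jp_j,\quad r_{j+1}=r_j-\alpha_jAp_j,\quad \beta_j=\frac{r_{j+1}^{\top}P^{-1}r_{j+1}}{r_j^{\top}P^{-1}r_j},\quad p_{j+1}=P^{-1}r_{j+1}+\beta_jp_j .$$ For every integer $k$ with $1\le k\le n-1$ and every real $\beta>1$ there is a symmetric positive definite matrix $P\in\mathbb{R}^{n\times n}$ such that $$\operatorname{tr}(P^{-1/2}AP^{-1/2})=n,\qquad \beta=e^{\mathcal{D}_{\mathrm{LD}}(A,P)/n},$$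 and a nonzero vector $r_0\in\mathbb{R}^n$ such that, for all $b,x_0\in\mathbb{R}^n$ with $b-Ax_0=r_0$, the $k$-th residual $r_k$ of PCG for $Ax=b$ with preconditioner $P$ and initial guess $x_0$ satisfies $$\|r_k\|_{P^{-1}}=\big(\beta^{n/k}-1\big)^{k/2}\|r_0\|_{P^{-1}}=\big(e^{\mathcal{D}_{\mathrm{LD}}(A,P)/k}-1\big)^{k/2}\|r_0\|_{P^{-1}} .$$ -/

import Mathlib

open scoped Matrix MatrixOrder

/-- The inverse `P^{-1/2}` of the positive definite square root of a positive definite matrix. -/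
noncomputable def invSqrt {n : ℕ} (P : Matrix (Fin n) (Fin n) ℝ) : Matrix (Fin n) (Fin n) ℝ :=
  (CFC.sqrt P)⁻¹

/-- The Bregman log determinant divergence `tr(A P⁻¹) - log det(A P⁻¹) - n`. -/
noncomputable def logDetDivergence {n : ℕ} (A P : Matrix (Fin n) (Fin n) ℝ) : ℝ :=
  (A * P⁻¹).trace - Real.log (A * P⁻¹).det - n

/-- The weighted norm `‖v‖_H = (vᵀ H v)^{1/2}` for a positive definite matrix `H`. -/
noncomputable def weightedNorm {n : ℕ} (H : Matrix (Fin n) (Fin n) ℝ) (v : Fin n → ℝ) : ℝ :=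
  Real.sqrt (v ⬝ᵥ (H *ᵥ v))

/-- The data `(x_k, r_k, p_k)` carried by the preconditioned conjugate gradient method:
iterate, residual and search direction. -/
structure PCGState (n : ℕ) where
  /-- the iterate -/
  x : Fin n → ℝ
  /-- the residual -/
  r : Fin n → ℝ
  /-- the search direction -/
  p : Fin n → ℝ

/-- One step of the method with `H = P⁻¹`. Once the residual is zero, both quotients are `0 / 0 = 0`
and the state stays at the solution. -/
noncomputable def pcgStep {n : ℕ} (A H : Matrix (Fin n) (Fin n) ℝ) (s : PCGState n) :
    PCGState n :=
  let α := (s.r ⬝ᵥ (H *ᵥ s.r)) / (s.p ⬝ᵥ (A *ᵥ s.p))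
  let r' := s.r - α • (A *ᵥ s.p)
  let β := (r' ⬝ᵥ (H *ᵥ r')) / (s.r ⬝ᵥ (H *ᵥ s.r))
  { x := s.x + α • s.p
    r := r'
    p := H *ᵥ r' + β • s.p }

/-- The `k`-th state of the preconditioned conjugate gradient method for `A x = b` with
preconditioner `P` and initial guess `x₀`. -/
noncomputable def pcg {n : ℕ} (A P : Matrix (Fin n) (Fin n) ℝ) (b x₀ : Fin n → ℝ) :
    ℕ → PCGState n
  | 0 =>
    { x := x₀
      r := b - A *ᵥ x₀
      p := P⁻¹ *ᵥ (b - A *ᵥ x₀) }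
  | k + 1 => pcgStep A P⁻¹ (pcg A P b x₀ k)

/-!
Write `A = R²` with `R = A^{1/2}`. If `L` is invertible and `P⁻¹ = R⁻¹ Lᵀ L R⁻¹`, then `A P⁻¹` is
similar to `Lᵀ L`, so trace and determinant of `A P⁻¹` are read off from `L`, which may be
prescribed freely. The method for `A` with preconditioner `P` is the plain conjugate gradient method
for `L Lᵀ` in other coordinates, and `L Lᵀ` is the tridiagonal Lanczos matrix of that method as soon
as `L` is lower bidiagonal: the entries of `L` encode the step lengths `αⱼ` and the ratios `βⱼ`.

Put `1 + t² = β^{n/k}` and `w = (1 + t²)^{-1/2}`, and let `L` have first `k` columns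
`w (eⱼ - t eⱼ₊₁)` and remaining columns `eⱼ` (`lanczosFactor`). All its columns are unit vectors, so
`tr (A P⁻¹) = n`, and `det (A P⁻¹) = w^{2k} = β^{-n}` (`trace_lanczosFactor`, `det_lanczosFactor`).
Started from the first column of `R L⁻¹`, the method has `αⱼ = 1 + t²` and `βⱼ = t²` in each of its
first `k` steps, so the residual norm is multiplied by `t` each time (`pcg_r_p_of_recurrence`). This
gives `‖r_k‖ = tᵏ ‖r₀‖`, and `t² = β^{n/k} - 1`.
-/

/-! ### Preconditioned conjugate gradients with constant coefficients -/

/-- If the vectors `v j` (scaled residuals) and `y j` (scaled search directions) satisfy the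
bidiagonal relations `A y_j = w (v_j - t v_{j+1})` and `H v_{j+1} = ℓ_{j+1} y_{j+1} - w t y_j`, with
the normalizations `v_jᵀ H v_j = 1` and `y_jᵀ A y_j = 1`, then the method started at `v 0` runs
through their multiples with constant reduction factor `t`. -/
lemma pcg_r_p_of_recurrence {n k : ℕ} {A P : Matrix (Fin n) (Fin n) ℝ} {t w : ℝ} (ht : t ≠ 0)
    (hw : w ≠ 0) {l : ℕ → ℝ} {v y : ℕ → Fin n → ℝ} (hl : ∀ j < k, l j = w)
    (hH0 : P⁻¹ *ᵥ v 0 = l 0 • y 0)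
    (hH : ∀ j < k, P⁻¹ *ᵥ v (j + 1) = l (j + 1) • y (j + 1) - (w * t) • y j)
    (hA : ∀ j < k, A *ᵥ y j = w • (v j - t • v (j + 1)))
    (hv : ∀ j ≤ k, v j ⬝ᵥ (P⁻¹ *ᵥ v j) = 1) (hy : ∀ j < k, y j ⬝ᵥ (A *ᵥ y j) = 1)
    {b x₀ : Fin n → ℝ} (h0 : b - A *ᵥ x₀ = v 0) :
    ∀ j ≤ k, (pcg A P b x₀ j).r = t ^ j • v j ∧ (pcg A P b x₀ j).p = (t ^ j * l j) • y j := by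
  intro j
  induction j with
  | zero => simp [pcg, h0, hH0]
  | succ j ih =>
    intro hj
    obtain ⟨hr, hp⟩ := ih (by omega)
    have hjk : j < k := by omega
    rw [hl j hjk] at hp
    have hα : ((pcg A P b x₀ j).r ⬝ᵥ (P⁻¹ *ᵥ (pcg A P b x₀ j).r)) /
        ((pcg A P b x₀ j).p ⬝ᵥ (A *ᵥ (pcg A P b x₀ j).p)) = (w ^ 2)⁻¹ := by
      rw [hr, hp]
      simp only [Matrix.mulVec_smul, smul_dotProduct, dotProduct_smul, hv j hjk.le, hy j hjk,
        smul_eq_mul]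
      field_simp
    have hr' : (pcg A P b x₀ (j + 1)).r = t ^ (j + 1) • v (j + 1) := by
      simp only [pcg, pcgStep]
      rw [hα, hr, hp, Matrix.mulVec_smul, hA j hjk]
      ext i
      simp only [Pi.sub_apply, Pi.smul_apply, smul_eq_mul]
      field_simp
      ring
    refine ⟨hr', ?_⟩
    have hβ : ((pcg A P b x₀ (j + 1)).r ⬝ᵥ (P⁻¹ *ᵥ (pcg A P b x₀ (j + 1)).r)) /
        ((pcg A P b x₀ j).r ⬝ᵥ (P⁻¹ *ᵥ (pcg A P b x₀ j).r)) = t ^ 2 := by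
      rw [hr', hr]
      simp only [Matrix.mulVec_smul, smul_dotProduct, dotProduct_smul, hv j hjk.le, hv (j + 1) hj,
        smul_eq_mul]
      field_simp
      ring
    have hp' : (pcg A P b x₀ (j + 1)).p = P⁻¹ *ᵥ (pcg A P b x₀ (j + 1)).r +
        (((pcg A P b x₀ (j + 1)).r ⬝ᵥ (P⁻¹ *ᵥ (pcg A P b x₀ (j + 1)).r)) /
          ((pcg A P b x₀ j).r ⬝ᵥ (P⁻¹ *ᵥ (pcg A P b x₀ j).r))) • (pcg A P b x₀ j).p := rfl
    rw [hp', hβ, hr', hp, Matrix.mulVec_smul, hH j hjk]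
    ext i
    simp only [Pi.sub_apply, Pi.add_apply, Pi.smul_apply, smul_eq_mul]
    ring

/-! ### The bidiagonal factor -/

/-- The standard basis vector `e_j` of `ℝⁿ`, indexed by a natural number; it is zero for `n ≤ j`. -/
def natBasis (n j : ℕ) : Fin n → ℝ := fun i => if (i : ℕ) = j then 1 else 0

/-- The diagonal of `lanczosFactor`: `w` in the first `k` places, then `1`. -/
def lanczosDiag (k : ℕ) (w : ℝ) (j : ℕ) : ℝ := if j < k then w else 1

/-- The lower bidiagonal matrix whose first `k` columns are `w (e_j - t e_{j+1})` and whose other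
columns are `e_j`. -/
def lanczosFactor (n k : ℕ) (t w : ℝ) : Matrix (Fin n) (Fin n) ℝ :=
  Matrix.of fun i j => if (i : ℕ) = j then lanczosDiag k w j
    else if (i : ℕ) = j + 1 ∧ (j : ℕ) < k then -(w * t) else 0

lemma natBasis_eq_single {n : ℕ} (j : Fin n) : natBasis n j = Pi.single j 1 := by
  ext i
  simp [natBasis, Pi.single_apply, Fin.ext_iff]

lemma natBasis_dotProduct_self {n j : ℕ} (hj : j < n) : natBasis n j ⬝ᵥ natBasis n j = 1 := by
  rw [show j = ((⟨j, hj⟩ : Fin n) : ℕ) from rfl, natBasis_eq_single]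
  simp

lemma natBasis_dotProduct_succ (n j : ℕ) : natBasis n j ⬝ᵥ natBasis n (j + 1) = 0 := by
  refine Finset.sum_eq_zero fun i _ => ?_
  simp only [natBasis]
  split_ifs <;> first | omega | simp

lemma mulVec_natBasis {n j : ℕ} (hj : j < n) (M : Matrix (Fin n) (Fin n) ℝ) :
    M *ᵥ natBasis n j = fun i => M i ⟨j, hj⟩ := by
  have h : natBasis n j = Pi.single ⟨j, hj⟩ 1 := natBasis_eq_single ⟨j, hj⟩
  rw [h, Matrix.mulVec_single_one]
  rfl

lemma lanczosFactor_mulVec {n k j : ℕ} (t w : ℝ) (hj : j < k) (hk : k < n) :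
    lanczosFactor n k t w *ᵥ natBasis n j = w • (natBasis n j - t • natBasis n (j + 1)) := by
  rw [mulVec_natBasis (hj.trans hk)]
  ext i
  simp only [lanczosFactor, lanczosDiag, Matrix.of_apply, natBasis, Pi.smul_apply, Pi.sub_apply,
    smul_eq_mul]
  split_ifs <;> first | omega | ring

lemma lanczosFactor_mulVec_of_le {n k j : ℕ} (t w : ℝ) (hj : k ≤ j) (hn : j < n) :
    lanczosFactor n k t w *ᵥ natBasis n j = natBasis n j := by
  rw [mulVec_natBasis hn]
  ext i
  simp only [lanczosFactor, lanczosDiag, Matrix.of_apply, natBasis]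
  split_ifs <;> first | omega | rfl

lemma lanczosFactor_transpose_mulVec_zero {n : ℕ} (k : ℕ) (t w : ℝ) (hn : 0 < n) :
    (lanczosFactor n k t w)ᵀ *ᵥ natBasis n 0 = lanczosDiag k w 0 • natBasis n 0 := by
  rw [mulVec_natBasis hn]
  ext i
  by_cases hi : (i : ℕ) = 0
  · simp [lanczosFactor, natBasis, hi]
  · simp [lanczosFactor, natBasis, hi, Ne.symm hi]

lemma lanczosFactor_transpose_mulVec_succ {n k j : ℕ} (t w : ℝ) (hj : j < k) (hk : k < n) :
    (lanczosFactor n k t w)ᵀ *ᵥ natBasis n (j + 1) =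
      lanczosDiag k w (j + 1) • natBasis n (j + 1) - (w * t) • natBasis n j := by
  rw [mulVec_natBasis (by omega)]
  ext i
  simp only [lanczosFactor, Matrix.transpose_apply, Matrix.of_apply, natBasis, Pi.smul_apply,
    Pi.sub_apply, smul_eq_mul]
  by_cases h1 : (i : ℕ) = j + 1
  · simp [h1]
  · by_cases h2 : (i : ℕ) = j
    · simp [h2, hj]
    · simp [h1, h2, Ne.symm h1, Ne.symm h2]

lemma trace_lanczosFactor {n k : ℕ} {t w : ℝ} (hk : k < n) (h : w ^ 2 * (1 + t ^ 2) = 1) :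
    ((lanczosFactor n k t w)ᵀ * lanczosFactor n k t w).trace = n := by
  -- The diagonal entries are the squared lengths of the columns, all equal to one.
  have hcol : ∀ j : Fin n, ((lanczosFactor n k t w)ᵀ * lanczosFactor n k t w) j j = 1 := by
    intro j
    have : ((lanczosFactor n k t w)ᵀ * lanczosFactor n k t w) j j =
        (lanczosFactor n k t w *ᵥ natBasis n j) ⬝ᵥ (lanczosFactor n k t w *ᵥ natBasis n j) := by
      rw [mulVec_natBasis j.2]
      rfl
    rw [this]
    by_cases hj : (j : ℕ) < k
    · rw [lanczosFactor_mulVec t w hj hk]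
      simp only [smul_dotProduct, dotProduct_smul, sub_dotProduct, dotProduct_sub,
        natBasis_dotProduct_self j.2, natBasis_dotProduct_self (show (j : ℕ) + 1 < n by omega),
        natBasis_dotProduct_succ, dotProduct_comm (natBasis n (j + 1)) (natBasis n j), smul_eq_mul]
      linear_combination h
    · rw [lanczosFactor_mulVec_of_le t w (by omega) j.2, natBasis_dotProduct_self j.2]
  simp [Matrix.trace, hcol]

lemma det_lanczosFactor {n k : ℕ} (t w : ℝ) (hk : k < n) :
    (lanczosFactor n k t w).det = w ^ k := by
  rw [Matrix.det_of_isLowerTriangular]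
  · simp only [lanczosFactor, Matrix.of_apply, if_true, lanczosDiag]
    rw [Fin.prod_univ_eq_prod_range (fun i => if i < k then w else 1) n, Finset.prod_ite,
      Finset.prod_const, Finset.prod_const_one, mul_one]
    congr 1
    rw [show (Finset.range n).filter (· < k) = Finset.range k by ext; simp; omega]
    simp
  · intro i j hij
    have : (i : ℕ) < j := hij
    simp only [lanczosFactor, Matrix.of_apply]
    split_ifs <;> first | omega | rfl

/-! ### The preconditioner -/

lemma trace_invSqrt_mul_mul_invSqrt {n : ℕ} (A : Matrix (Fin n) (Fin n) ℝ)
    {P : Matrix (Fin n) (Fin n) ℝ} (hP : P.PosDef) :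
    (invSqrt P * A * invSqrt P).trace = (A * P⁻¹).trace := by
  rw [Matrix.mul_assoc, Matrix.trace_mul_comm, Matrix.mul_assoc, invSqrt, ← Matrix.mul_inv_rev,
    CFC.sqrt_mul_sqrt_self P (Matrix.nonneg_iff_posSemidef.2 hP.posSemidef)]

/-- Any invertible `L` arises from a preconditioner `P` of `A` with `A P⁻¹` similar to `Lᵀ L`. The
columns of `W` form a `P⁻¹`-orthonormal basis, used to write residuals, and those of `Y` an
`A`-orthonormal basis, used to write search directions. -/
lemma exists_preconditioner_of_factor {n : ℕ} {A L : Matrix (Fin n) (Fin n) ℝ} (hA : A.PosDef)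
    (hL : L.det ≠ 0) :
    ∃ P W Y : Matrix (Fin n) (Fin n) ℝ, P.PosDef ∧
      (A * P⁻¹).trace = (Lᵀ * L).trace ∧ (A * P⁻¹).det = L.det ^ 2 ∧
      P⁻¹ * W = Y * Lᵀ ∧ A * Y = W * L ∧ Wᵀ * (P⁻¹ * W) = 1 ∧ Yᵀ * (A * Y) = 1 := by
  obtain ⟨R, hRR, hRT⟩ : ∃ R : Matrix (Fin n) (Fin n) ℝ, R * R = A ∧ Rᵀ = R := by
    refine ⟨CFC.sqrt A, CFC.sqrt_mul_sqrt_self A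
      (Matrix.nonneg_iff_posSemidef.2 hA.posSemidef), ?_⟩
    have := (Matrix.nonneg_iff_posSemidef.1 (CFC.sqrt_nonneg A)).isHermitian
    simpa [Matrix.IsHermitian, Matrix.conjTranspose_eq_transpose_of_trivial] using this
  have hRdet : R.det ≠ 0 := by
    intro h
    have := hA.det_pos
    rw [← hRR, Matrix.det_mul, h] at this
    simp at this
  have hRu : IsUnit R.det := isUnit_iff_ne_zero.2 hRdet
  have hLu : IsUnit L.det := isUnit_iff_ne_zero.2 hL
  have hLTu : IsUnit Lᵀ.det := by rwa [Matrix.det_transpose]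
  set W := R * L⁻¹ with hW
  have hWT : Wᵀ = Lᵀ⁻¹ * R := by
    rw [hW, Matrix.transpose_mul, hRT, Matrix.transpose_nonsing_inv]
  have hWdet : W.det ≠ 0 := by
    rw [hW, Matrix.det_mul, Matrix.det_nonsing_inv, Ring.inverse_eq_inv']
    exact mul_ne_zero hRdet (inv_ne_zero hL)
  have hPinv : (W * Wᵀ)⁻¹ = R⁻¹ * (Lᵀ * (L * R⁻¹)) := by
    rw [hWT, hW, Matrix.mul_inv_rev, Matrix.mul_inv_rev, Matrix.mul_inv_rev,
      Matrix.nonsing_inv_nonsing_inv _ hLu, Matrix.nonsing_inv_nonsing_inv _ hLTu, Matrix.mul_assoc]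
  have hPpd : (W * Wᵀ).PosDef := by
    have hs : (W * Wᵀ).PosSemidef := by
      simpa [Matrix.conjTranspose_eq_transpose_of_trivial] using
        Matrix.posSemidef_self_mul_conjTranspose W
    rw [hs.posDef_iff_det_ne_zero, Matrix.det_mul, Matrix.det_transpose]
    exact mul_ne_zero hWdet hWdet
  have hAP : A * (W * Wᵀ)⁻¹ = R * (Lᵀ * L) * R⁻¹ := by
    rw [hPinv, ← hRR, Matrix.mul_assoc, Matrix.mul_nonsing_inv_cancel_left _ _ hRu]
    simp only [Matrix.mul_assoc]
  have hPW : (W * Wᵀ)⁻¹ * W = R⁻¹ * Lᵀ := by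
    rw [hPinv, hW]
    simp only [Matrix.mul_assoc]
    rw [Matrix.nonsing_inv_mul_cancel_left _ _ hRu, Matrix.mul_nonsing_inv _ hLu, Matrix.mul_one]
  have hAY : A * R⁻¹ = R := by
    rw [← hRR, Matrix.mul_assoc, Matrix.mul_nonsing_inv _ hRu, Matrix.mul_one]
  refine ⟨W * Wᵀ, W, R⁻¹, hPpd, ?_, ?_, hPW, ?_, ?_, ?_⟩
  · rw [hAP, Matrix.trace_mul_comm, Matrix.nonsing_inv_mul_cancel_left _ _ hRu]
  · rw [hAP, Matrix.det_conj ((Matrix.isUnit_iff_isUnit_det R).2 hRu), Matrix.det_mul,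
      Matrix.det_transpose, sq]
  · rw [hAY, hW, Matrix.nonsing_inv_mul_cancel_right _ _ hLu]
  · rw [hPW, hWT, Matrix.mul_assoc, Matrix.mul_nonsing_inv_cancel_left _ _ hRu,
      Matrix.nonsing_inv_mul _ hLTu]
  · rw [hAY, Matrix.transpose_nonsing_inv, hRT, Matrix.nonsing_inv_mul _ hRu]

lemma mulVec_natBasis_dotProduct {n j : ℕ} (hj : j < n) {M N : Matrix (Fin n) (Fin n) ℝ}
    (h : Mᵀ * (N * M) = 1) :
    (M *ᵥ natBasis n j) ⬝ᵥ (N *ᵥ (M *ᵥ natBasis n j)) = 1 := by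
  rw [Matrix.mulVec_mulVec, ← Matrix.vecMul_transpose, ← Matrix.dotProduct_mulVec,
    Matrix.mulVec_mulVec, h, Matrix.one_mulVec, natBasis_dotProduct_self hj]

/-! ### Sharpness of the residual bound -/

theorem mainTheorem5 (n : ℕ) (A : Matrix (Fin n) (Fin n) ℝ) (hA : A.PosDef)
    (k : ℕ) (hk : 1 ≤ k) (hkn : k ≤ n - 1) (β : ℝ) (hβ : 1 < β) :
    ∃ P : Matrix (Fin n) (Fin n) ℝ, P.PosDef ∧
      (invSqrt P * A * invSqrt P).trace = n ∧
      β = Real.exp (logDetDivergence A P / n) ∧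
      ∃ r₀ : Fin n → ℝ, r₀ ≠ 0 ∧
        ∀ b x₀ : Fin n → ℝ, b - A *ᵥ x₀ = r₀ →
          weightedNorm P⁻¹ (pcg A P b x₀ k).r =
              (β ^ ((n : ℝ) / k) - 1) ^ ((k : ℝ) / 2) * weightedNorm P⁻¹ r₀ ∧
          weightedNorm P⁻¹ (pcg A P b x₀ k).r =
              (Real.exp (logDetDivergence A P / k) - 1) ^ ((k : ℝ) / 2) * weightedNorm P⁻¹ r₀ := by
  have hkn' : k < n := by omega
  have hβ0 : 0 < β := by linarith
  have hk0 : (0 : ℝ) < k := by exact_mod_cast hk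
  have hn0 : (0 : ℝ) < n := by exact_mod_cast (show 0 < n by omega)
  set K : ℝ := β ^ ((n : ℝ) / k) with hK
  have hK1 : 1 < K := Real.one_lt_rpow hβ (by positivity)
  have hK0 : 0 < K := by linarith
  set t : ℝ := √(K - 1) with ht_def
  set w : ℝ := (√K)⁻¹ with hw_def
  have ht : 0 < t := Real.sqrt_pos.2 (by linarith)
  have hw : 0 < w := inv_pos.2 (Real.sqrt_pos.2 hK0)
  have ht2 : t ^ 2 = K - 1 := Real.sq_sqrt (by linarith)
  have hw2 : w ^ 2 = K⁻¹ := by rw [hw_def, inv_pow, Real.sq_sqrt hK0.le]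
  have htw : w ^ 2 * (1 + t ^ 2) = 1 := by
    rw [ht2, hw2, add_sub_cancel, inv_mul_cancel₀ hK0.ne']
  have hLdet := det_lanczosFactor t w hkn'
  obtain ⟨P, W, Y, hP, htr, hdet, hPW, hAY, hWW, hYY⟩ :=
    exists_preconditioner_of_factor (L := lanczosFactor n k t w) hA
      (by rw [hLdet]; exact (pow_pos hw k).ne')
  rw [trace_lanczosFactor hkn' htw] at htr
  have hD : logDetDivergence A P = n * Real.log β := by
    rw [logDetDivergence, htr, hdet, hLdet, ← pow_mul, mul_comm k 2, pow_mul, hw2, Real.log_pow,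
      Real.log_inv, hK, Real.log_rpow hβ0]
    field_simp
    ring
  have hexp : Real.exp (logDetDivergence A P / k) = K := by
    rw [hD, hK, Real.rpow_def_of_pos hβ0]
    congr 1
    ring
  have hnorm : ∀ j < n, (W *ᵥ natBasis n j) ⬝ᵥ (P⁻¹ *ᵥ (W *ᵥ natBasis n j)) = 1 :=
    fun j hj => mulVec_natBasis_dotProduct hj hWW
  refine ⟨P, hP, (trace_invSqrt_mul_mul_invSqrt A hP).trans htr, ?_, W *ᵥ natBasis n 0, ?_, ?_⟩
  · rw [hD, mul_div_cancel_left₀ _ hn0.ne', Real.exp_log hβ0]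
  · intro h
    simpa [h] using hnorm 0 (by omega)
  · intro b x₀ h0
    rw [hexp, and_self]
    have hr := (pcg_r_p_of_recurrence (k := k) (l := lanczosDiag k w)
      (v := fun j => W *ᵥ natBasis n j) (y := fun j => Y *ᵥ natBasis n j) ht.ne' hw.ne'
      (fun j hj => by simp [lanczosDiag, hj])
      (by
        rw [Matrix.mulVec_mulVec, hPW, ← Matrix.mulVec_mulVec,
          lanczosFactor_transpose_mulVec_zero k t w (by omega), Matrix.mulVec_smul])
      (fun j hj => by
        rw [Matrix.mulVec_mulVec, hPW, ← Matrix.mulVec_mulVec,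
          lanczosFactor_transpose_mulVec_succ t w hj hkn', Matrix.mulVec_sub, Matrix.mulVec_smul,
          Matrix.mulVec_smul])
      (fun j hj => by
        rw [Matrix.mulVec_mulVec, hAY, ← Matrix.mulVec_mulVec, lanczosFactor_mulVec t w hj hkn',
          Matrix.mulVec_smul, Matrix.mulVec_sub, Matrix.mulVec_smul])
      (fun j hj => hnorm j (by omega))
      (fun j hj => mulVec_natBasis_dotProduct (by omega) hYY) h0 k le_rfl).1
    rw [hr, weightedNorm, weightedNorm, Matrix.mulVec_smul, smul_dotProduct, dotProduct_smul,
      hnorm k hkn', hnorm 0 (by omega), smul_eq_mul, smul_eq_mul, mul_one, Real.sqrt_one, mul_one,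
      Real.sqrt_mul_self (pow_pos ht k).le, ← ht2, ← Real.rpow_natCast t 2, ← Real.rpow_mul ht.le,
      ← Real.rpow_natCast t k]
    congr 1
    push_cast
    ring
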